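/- Let $X$ be a complex Banach space and let $\{T(t)\}_{t\ge 0}\subset L(X)$ be a bounded $C_0$-semigroup that is Eberlein-weakly almost periodic, i.e. every orbit $\{T(t)x : t\ge 0\}$ is weakly relatively compact in $X$. Notation. Let $X_{ap}$ be the set of $x\in X$ such that $t\mapsto T(t)x$ is the restriction to $[0,\infty)$ of an almost periodic function $\mathbb R\to X$ (a bounded continuous function whose translates form a relatively compact set in the sup-norm), and let $X_0$ be the set of $x\in X$ such that $T(s_\alpha)x\to 0$ weakly for some net $(s_\alpha)\subset[0,\infty)$. Let $\mathcal T\subset L(X)$ be the closure of $\{T(t)\}_{t\ge0}$ in the weak operator topology. Let $X^\odot=\{x^*\in X^*:\lim_{t\to0}\|T(t)^*x^*-x^*\|=0\}$, let $T^\odot(t)$ be the restriction of $T(t)^*$ to $X^\odot$, let $X^{\odot\odot}\subset (X^\odot)^*$ be the sun-dual of $X^\odot$ with respect to $\{T^\odot(t)\}_{t\ge0}$, and let $j:X\to X^{\odot\odot}$ be the canonical map. Let $\mathcal T^\odot\subset L(X^\odot)$ be the closure of $\{T^\odot(t)\}_{t\ge0}$ in the topology of pointwise $\sigma(X^\odot,X)$-convergence.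 A vector $y\in X^\odot$ is reversible ($y\in X^\odot_{rev}$) if for every net $(s_\alpha)\subset[0,\infty)$ along which $T^\odot(s_\alpha)y$ is $\sigma(X^\odot,X)$-convergent in $X^\odot$ there is a net $(t_\gamma)\subset[0,\infty)$ with $\lim_\gamma\lim_\alpha T^\odot(t_\gamma)T^\odot(s_\alpha)y=y$ in $\sigma(X^\odot,X)$; it is a flight vector ($y\in X^\odot_{fl}$) if $T^\odot(s_\alpha)y\to0$ in $\sigma(X^\odot,X)$ for some net $(s_\alpha)\subset[0,\infty)$. An idempotent $e$ of a semigroup $S$ is minimal for a relation $\le$ on the idempotents if $f\le e$ implies $e\le f$ for every idempotent $f\in S$; the relations considered are $e\le_L f:\Leftrightarrow ef=e$ and $e\le_R f:\Leftrightarrow fe=e$. Finally, for $U\in L(X,X^{\odot\odot})$ let $U^*|_{X^\odot}:X^\odot\to X^*$ be given by $\langle x,U^*x^\odot\rangle=\langle Ux,x^\odot\rangle$; let $L_{\mathcal T}(X,X^{\odot\odot})$ be the set of those $U$ for which $U^*(X^\odot)\subset X^\odot$ and the adjoint of the resulting operator $U^\odot\in L(X^\odot)$ maps $X^{\odot\odot}$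 into $X^{\odot\odot}$; let $L_{\mathcal T}(X^\odot)=\{R\in L(X^\odot):R^*(X^{\odot\odot})\subset X^{\odot\odot}\}$; and let $\eta^\odot:L_{\mathcal T}(X,X^{\odot\odot})\to L_{\mathcal T}(X^\odot)$, $\eta^\odot(U)=U^\odot$. Theorem 7.4. There are bounded projections $V:X\to X$ and $P^\odot:X^\odot\to X^\odot$ such that: 1. $V(X)=X_{ap}$, $\ker V=X_0$, and $X=X_{ap}\oplus X_0$. 2. Minimal idempotents are unique: for $\le_L$ as well as for $\le_R$, $V$ is the one and only minimal idempotent of $\mathcal T$, and $P^\odot$ is the one and only minimal idempotent of $\mathcal T^\odot$. 3. With $X^\odot_a:=P^\odot X^\odot$ and $X^\odot_0:=(I-P^\odot)X^\odot$ one has $X^\odot_a=X^\odot_{rev}$, $X^\odot_0=X^\odot_{fl}$ and $X^\odot=X^\odot_{rev}\oplus X^\odot_{fl}$. 4. $j\circ V\in L_{\mathcal T}(X,X^{\odot\odot})$ and $P^\odot=\eta^\odot(j\circ V)$. -/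

import Mathlib

open Filter Topology Set
open scoped NNReal BoundedContinuousFunction

set_option maxSynthPendingDepth 6

/-- A bounded `C₀`-semigroup `{T(t)}_{t ≥ 0}` of bounded linear operators on a complex normed
space: `T(0) = I`, `T(s+t) = T(s)T(t)`, `sup_t ‖T(t)‖ < ∞`, and `T(t)x → x` in norm as `t → 0`. -/
structure BoundedC0Semigroup (X : Type*) [NormedAddCommGroup X] [NormedSpace ℂ X] where
  /-- the operators `T(t)` -/
  op : ℝ≥0 → X →L[ℂ] X
  op_zero : op 0 = ContinuousLinearMap.id ℂ X
  op_add : ∀ s t, op (s + t) = (op s).comp (op t)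
  bounded : ∃ M : ℝ, ∀ t, ‖op t‖ ≤ M
  tendsto_zero : ∀ x, Tendsto (fun t => op t x) (𝓝 0) (𝓝 x)

/-! ### Idempotents of a semigroup of operators -/

section Idempotents

variable {A : Type*} [Mul A]

/-- `e ≤_L f` if `ef = e`. -/
def IdemLeL (e f : A) : Prop := e * f = e

/-- `e ≤_R f` if `fe = e`. -/
def IdemLeR (e f : A) : Prop := f * e = e

/-- `e` is a minimal idempotent of `S` with respect to the relation `le` on the idempotents. -/
def IsMinimalIdempotent (le : A → A → Prop) (S : Set A) (e : A) : Prop :=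
  (e ∈ S ∧ IsIdempotentElem e) ∧
    ∀ f, f ∈ S ∧ IsIdempotentElem f → le f e → le e f

end Idempotents

/-! ### Reversible vectors and flight vectors

The map `ι : E → W` puts on `E` the topology induced from `W`; limits are taken in this topology.
Nets in `ℝ≥0` are described by the (proper) filters that they generate. -/

section Vectors

variable {E W : Type*} [NormedAddCommGroup E] [NormedSpace ℂ E] [TopologicalSpace W]

/-- `y` is reversible: for every net `s_α` along which `T(s_α)y` converges there is a net `t_γ`
with `lim_γ lim_α T(t_γ)T(s_α)y = y`. -/
def IsReversibleVector (ι : E → W) (T : BoundedC0Semigroup E) (y : E) : Prop :=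
  ∀ F : Filter ℝ≥0, F.NeBot → (∃ z : E, Tendsto (fun s => ι (T.op s y)) F (𝓝 (ι z))) →
    ∃ G : Filter ℝ≥0, G.NeBot ∧ ∃ g : ℝ≥0 → E,
      (∀ t, Tendsto (fun s => ι (T.op t (T.op s y))) F (𝓝 (ι (g t)))) ∧
      Tendsto (fun t => ι (g t)) G (𝓝 (ι y))

/-- `y` is a flight vector: `lim_α T(s_α)y = 0` for some net `s_α`. -/
def IsFlightVector (ι : E → W) (T : BoundedC0Semigroup E) (y : E) : Prop :=
  ∃ F : Filter ℝ≥0, F.NeBot ∧ Tendsto (fun s => ι (T.op s y)) F (𝓝 (ι 0))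

end Vectors

/-- A bounded continuous function on `ℝ` is almost periodic (in the sense of Bochner) if its
translates `f(· + h)`, `h ∈ ℝ`, form a relatively compact set in the sup-norm. -/
def IsAlmostPeriodic {X : Type*} [NormedAddCommGroup X] (f : ℝ →ᵇ X) : Prop :=
  IsCompact (closure (range fun h : ℝ => f.compContinuous (ContinuousMap.addRight h)))

namespace BoundedC0Semigroup

variable {X : Type*} [NormedAddCommGroup X] [NormedSpace ℂ X]

/-- Every orbit is relatively compact in the weak topology of `X`. -/
def IsEberleinWAP (T : BoundedC0Semigroup X) : Prop :=
  ∀ x, IsCompact (closure (range fun t => toWeakSpace ℂ X (T.op t x)))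

/-- `X_ap`: the vectors whose orbit map is the restriction to `[0, ∞)` of an almost periodic
function `ℝ → X`. -/
def almostPeriodicVectors (T : BoundedC0Semigroup X) : Set X :=
  {x | ∃ f : ℝ →ᵇ X, IsAlmostPeriodic f ∧ ∀ t : ℝ≥0, T.op t x = f t}

/-- `X_0`: the flight vectors with respect to the weak topology. -/
def flightVectors (T : BoundedC0Semigroup X) : Set X :=
  {x | IsFlightVector (toWeakSpace ℂ X) T x}

/-- The closure of `{T(t)}` in `L(X)` in the weak operator topology. -/
def weakCompactification (T : BoundedC0Semigroup X) : Set (X →L[ℂ] X) :=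
  {S | ContinuousLinearMapWOT.ofCLM S ∈
    closure (range fun t => ContinuousLinearMapWOT.ofCLM (T.op t))}

lemma op_comm (T : BoundedC0Semigroup X) (s t : ℝ≥0) :
    (T.op s).comp (T.op t) = (T.op t).comp (T.op s) := by
  rw [← T.op_add, ← T.op_add, add_comm]

/-! ### The sun-dual semigroup -/

/-- `X^⊙ = {x^* ∈ X^* : ‖T^*(t)x^* - x^*‖ → 0 as t → 0}`. -/
def sunDual (T : BoundedC0Semigroup X) : Submodule ℂ (StrongDual ℂ X) where
  carrier := {f | Tendsto (fun t => f.comp (T.op t)) (𝓝 0) (𝓝 f)}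
  zero_mem' := by simp
  add_mem' {f g} hf hg := by
    simpa using Tendsto.add (hf : Tendsto _ _ _) (hg : Tendsto _ _ _)
  smul_mem' c f hf := by
    simpa using Tendsto.const_smul (hf : Tendsto _ _ _) c

lemma comp_mem_sunDual (T : BoundedC0Semigroup X) (s : ℝ≥0) {f : StrongDual ℂ X}
    (hf : f ∈ T.sunDual) : f.comp (T.op s) ∈ T.sunDual := by
  have h : Tendsto (fun t => (f.comp (T.op t)).comp (T.op s)) (𝓝 0) (𝓝 (f.comp (T.op s))) :=
    (((ContinuousLinearMap.compL ℂ X X ℂ).flip (T.op s)).continuous.tendsto f).comp hf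
  refine h.congr fun t => ?_
  rw [ContinuousLinearMap.comp_assoc, T.op_comm, ← ContinuousLinearMap.comp_assoc]

/-- `T^⊙(t)`: the restriction of the adjoint `T^*(t)` to `X^⊙`. -/
noncomputable def sunOp (T : BoundedC0Semigroup X) (t : ℝ≥0) : T.sunDual →L[ℂ] T.sunDual :=
  (((ContinuousLinearMap.compL ℂ X X ℂ).flip (T.op t)).comp T.sunDual.subtypeL).codRestrict
    T.sunDual fun f => T.comp_mem_sunDual t f.2

@[simp] lemma coe_sunOp (T : BoundedC0Semigroup X) (t : ℝ≥0) (f : T.sunDual) :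
    (T.sunOp t f : StrongDual ℂ X) = (f : StrongDual ℂ X).comp (T.op t) := rfl

/-- The sun-dual semigroup `{T^⊙(t)}_{t ≥ 0}` on `X^⊙`. -/
noncomputable def sun (T : BoundedC0Semigroup X) : BoundedC0Semigroup T.sunDual where
  op := T.sunOp
  op_zero := by
    ext f x
    simp [T.op_zero]
  op_add s t := by
    ext f x
    simp [add_comm s t, T.op_add]
  bounded := by
    obtain ⟨M, hM⟩ := T.bounded
    refine ⟨M, fun t => ContinuousLinearMap.opNorm_le_bound _ ((norm_nonneg _).trans (hM 0))
      fun f => ?_⟩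
    calc ‖T.sunOp t f‖ = ‖(f : StrongDual ℂ X).comp (T.op t)‖ := rfl
      _ ≤ ‖(f : StrongDual ℂ X)‖ * ‖T.op t‖ := ContinuousLinearMap.opNorm_comp_le _ _
      _ ≤ ‖f‖ * M := mul_le_mul_of_nonneg_left (hM t) (norm_nonneg _)
      _ = M * ‖f‖ := mul_comm _ _
  tendsto_zero f := tendsto_subtype_rng.2 f.2

/-- `X^⊙⊙`, the sun-dual of `X^⊙` with respect to `{T^⊙(t)}`; it consists of functionals
on `X^⊙`. -/
noncomputable abbrev sunSunDual (T : BoundedC0Semigroup X) :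
    Submodule ℂ (StrongDual ℂ T.sunDual) :=
  T.sun.sunDual

/-- Evaluation at `x ∈ X`, as a functional on `X^⊙`. -/
noncomputable def sunEval (T : BoundedC0Semigroup X) : X →L[ℂ] StrongDual ℂ T.sunDual :=
  T.sunDual.subtypeL.flip

@[simp] lemma sunEval_apply (T : BoundedC0Semigroup X) (x : X) (f : T.sunDual) :
    T.sunEval x f = (f : StrongDual ℂ X) x := rfl

lemma sunEval_mem (T : BoundedC0Semigroup X) (x : X) : T.sunEval x ∈ T.sunSunDual := by
  have h : Tendsto (fun t => T.sunEval (T.op t x)) (𝓝 0) (𝓝 (T.sunEval x)) :=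
    (T.sunEval.continuous.tendsto x).comp (T.tendsto_zero x)
  exact h

/-- The canonical map `j : X → X^⊙⊙`. -/
noncomputable def sunEmbedding (T : BoundedC0Semigroup X) : X →L[ℂ] T.sunSunDual :=
  T.sunEval.codRestrict T.sunSunDual T.sunEval_mem

/-- For `U : X → X^⊙⊙`, the operator `X^⊙ → X^*`, `x^⊙ ↦ (x ↦ ⟨Ux, x^⊙⟩)`, that is, the
restriction to `X^⊙` of the adjoint `U^*`. -/
noncomputable def preEta (T : BoundedC0Semigroup X) (U : X →L[ℂ] T.sunSunDual) :
    T.sunDual →L[ℂ] StrongDual ℂ X :=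
  (T.sunSunDual.subtypeL.comp U).flip

/-- `L_𝒯(X^⊙) = {R ∈ L(X^⊙) : R^*(X^⊙⊙) ⊂ X^⊙⊙}`. -/
def sunOperators (T : BoundedC0Semigroup X) : Set (T.sunDual →L[ℂ] T.sunDual) :=
  {R | ∀ ξ ∈ T.sunSunDual, ξ.comp R ∈ T.sunSunDual}

/-- `L_𝒯(X, X^⊙⊙) = {U ∈ L(X, X^⊙⊙) : U^*(X^⊙) ⊂ X^⊙, U^{⊙*}(X^⊙⊙) ⊂ X^⊙⊙}`, where `U^⊙` is
the restriction of `U^*` to an operator on `X^⊙`. -/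
def sunSunOperators (T : BoundedC0Semigroup X) : Set (X →L[ℂ] T.sunSunDual) :=
  {U | ∃ h : ∀ y, T.preEta U y ∈ T.sunDual,
    ∀ ξ ∈ T.sunSunDual, ξ.comp ((T.preEta U).codRestrict T.sunDual h) ∈ T.sunSunDual}

/-- `η^⊙ : L_𝒯(X, X^⊙⊙) → L_𝒯(X^⊙)`, `⟨x, η^⊙(U)x^⊙⟩ = ⟨Ux, x^⊙⟩`. -/
noncomputable def eta (T : BoundedC0Semigroup X) (U : T.sunSunOperators) : T.sunOperators :=
  ⟨(T.preEta U.1).codRestrict T.sunDual U.2.choose, U.2.choose_spec⟩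

lemma eta_apply (T : BoundedC0Semigroup X) (U : T.sunSunOperators) (f : T.sunDual) (x : X) :
    (((T.eta U).1 f : T.sunDual) : StrongDual ℂ X) x
      = (U.1 x : StrongDual ℂ T.sunDual) f := rfl

/-- `X^⊙` with values in `X^*` with the weak-star topology `σ(X^*, X)`. -/
noncomputable def sunToWeakDual (T : BoundedC0Semigroup X) (f : T.sunDual) : WeakDual ℂ X :=
  StrongDual.toWeakDual (f : StrongDual ℂ X)

/-- The reversible vectors of `X^⊙`, with respect to `σ(X^⊙, X)`. -/
def sunReversible (T : BoundedC0Semigroup X) : Set T.sunDual :=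
  {f | IsReversibleVector T.sunToWeakDual T.sun f}

/-- The flight vectors of `X^⊙`, with respect to `σ(X^⊙, X)`. -/
def sunFlight (T : BoundedC0Semigroup X) : Set T.sunDual :=
  {f | IsFlightVector T.sunToWeakDual T.sun f}

/-- The closure of `{T^⊙(t)}` in `L(X^⊙)` in the topology of pointwise `σ(X^⊙, X)`-convergence.
On bounded sets of operators this is the weak-star topology of `L(X^⊙, X^*)`, the dual of the
projective tensor product of `X^⊙` and `X`; balls are closed in both topologies, so that the
closures of a bounded set agree. -/
def sunCompactification (T : BoundedC0Semigroup X) : Set (T.sunDual →L[ℂ] T.sunDual) :=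
  {R | (fun f => T.sunToWeakDual (R f)) ∈
    closure (range fun (t : ℝ≥0) (f : T.sunDual) => T.sunToWeakDual (T.sun.op t f))}

end BoundedC0Semigroup

/-! This is the Jacobs–de Leeuw–Glicksberg splitting. Since orbits are weakly relatively compact,
the weak operator closure 𝒯 is a compact commutative semigroup with separately continuous product
(`isCompact_wotClosure`). Such a semigroup has an idempotent V for which V𝒯 is a group, and V is
then its only minimal idempotent.

Flight vectors are annihilated by V because every S ∈ 𝒯 divides V. On the group V𝒯 a Baire category
argument, using separability of orbits, turns weak into strong continuity
(`continuousOn_kernelGroup_apply`). So orbits of x ∈ VX under the group are norm compact, and T(t)V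
extends to a one-parameter group whose orbits are almost periodic. Conversely, an almost periodic
orbit returns close to x after passing close to Vx, which forces x ∈ VX.

On the sun-dual, the closure 𝒯^⊙ is exactly {S^⊙ : S ∈ 𝒯} (`mem_sunCompactification_iff`), so P =
V^⊙ inherits the algebra of V. Reversible and flight vectors are read off from it. -/

section AbstractSemigroup

/-! ### Idempotents in compact commutative semigroups -/

/-- A compact commutative submonoid `K` of a Hausdorff semitopological monoid has an idempotent `e`
such that `eK` is a group. -/
theorem exists_idempotent_forall_exists_mul_eq {M : Type*} [Monoid M] [TopologicalSpace M]
    [T2Space M] [SeparatelyContinuousMul M] {K : Set M} (hK : IsCompact K) (h1 : (1 : M) ∈ K)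
    (hmul : ∀ a ∈ K, ∀ b ∈ K, a * b ∈ K) (hcomm : ∀ a ∈ K, ∀ b ∈ K, a * b = b * a) :
    ∃ e ∈ K, e * e = e ∧ ∀ s ∈ K, ∃ r ∈ K, e * s * r = e := by
  have hcpt : ∀ a : K, IsCompact ((a.1 * ·) '' K) := fun a => hK.image (continuous_const_mul a.1)
  have : Nonempty K := ⟨⟨1, h1⟩⟩
  -- The compact sets aK are directed, since abK lies in both aK and bK. A common point k is
  -- divisible by every element of K.
  obtain ⟨k, hk⟩ : (⋂ a : K, (a.1 * ·) '' K).Nonempty := by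
    refine IsCompact.nonempty_iInter_of_directed_nonempty_isCompact_isClosed _ ?_
      (fun a => ⟨_, 1, h1, rfl⟩) hcpt (fun a => (hcpt a).isClosed)
    intro a b
    refine ⟨⟨a * b, hmul _ a.2 _ b.2⟩, ?_, ?_⟩
    · rintro _ ⟨c, hc, rfl⟩
      exact ⟨b * c, hmul _ b.2 _ hc, (mul_assoc _ _ _).symm⟩
    · rintro _ ⟨c, hc, rfl⟩
      refine ⟨a * c, hmul _ a.2 _ hc, ?_⟩
      simp only
      rw [← mul_assoc, hcomm _ b.2 _ a.2]
  have hk' : ∀ a ∈ K, ∃ c ∈ K, a * c = k := fun a ha => by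
    simpa using mem_iInter.1 hk ⟨a, ha⟩
  have hkK : k ∈ K := by
    obtain ⟨c, hc, h⟩ := hk' 1 h1
    exact h ▸ hmul _ h1 _ hc
  -- Dividing k by k² gives k²r = k, whence kr is idempotent.
  obtain ⟨r, hr, hkr⟩ := hk' _ (hmul _ hkK _ hkK)
  have hek : k * r * k = k := by rw [mul_assoc, hcomm r hr k hkK, ← mul_assoc, hkr]
  refine ⟨k * r, hmul _ hkK _ hr, by rw [← mul_assoc, hek], fun s hs => ?_⟩
  have hekr := hmul _ hkK _ hr
  obtain ⟨c, hc, h⟩ := hk' _ (hmul _ hekr _ hs)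
  exact ⟨c * r, hmul _ hc _ hr, by rw [← mul_assoc, h]⟩

/-- In a commutative semigroup `K`, an idempotent `e` such that `eK` is a group is the only
minimal idempotent. -/
theorem isMinimalIdempotent_iff_eq {A : Type*} [Semigroup A] {K : Set A} {e : A} (he : e ∈ K)
    (hee : e * e = e)
    (hcomm : ∀ a ∈ K, ∀ b ∈ K, a * b = b * a) (hinv : ∀ s ∈ K, ∃ r ∈ K, e * s * r = e) (q : A) :
    (IsMinimalIdempotent IdemLeL K q ↔ q = e) ∧ (IsMinimalIdempotent IdemLeR K q ↔ q = e) := by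
  -- In the group eK the element ef is idempotent, hence the unit. So e lies below every idempotent.
  have absorb : ∀ f ∈ K, IsIdempotentElem f → e * f = e := fun f hf hff => by
    obtain ⟨r, hr, h⟩ := hinv f hf
    calc e * f = e * f * r * f := by rw [h]
      _ = e * (f * f) * r := by
        rw [mul_assoc (e * f), hcomm r hr f hf, ← mul_assoc, ← mul_assoc]
      _ = e := by rw [hff.eq, h]
  refine ⟨⟨fun ⟨⟨hq, hqq⟩, hmin⟩ => ?_, ?_⟩, ⟨fun ⟨⟨hq, hqq⟩, hmin⟩ => ?_, ?_⟩⟩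
  · have h := hmin e ⟨he, hee⟩ (absorb q hq hqq)
    rw [← h, hcomm q hq e he, absorb q hq hqq]
  · rintro rfl
    refine ⟨⟨he, hee⟩, fun f ⟨hf, hff⟩ _ => absorb f hf hff⟩
  · have h := hmin e ⟨he, hee⟩ (by rw [IdemLeR, hcomm q hq e he, absorb q hq hqq])
    rw [← h, absorb q hq hqq]
  · rintro rfl
    refine ⟨⟨he, hee⟩, fun f ⟨hf, hff⟩ _ => ?_⟩
    rw [IdemLeR, hcomm f hf q he, absorb f hf hff]

end AbstractSemigroup

/-! ### Pointwise weak convergence of operators -/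

section WeakTopology

variable {E : Type*} [NormedAddCommGroup E] [NormedSpace ℂ E]

theorem tendsto_toWeakSpace_iff {α : Type*} {l : Filter α} {f : α → E} {x : E} :
    Tendsto (fun a => toWeakSpace ℂ E (f a)) l (𝓝 (toWeakSpace ℂ E x)) ↔
      ∀ y : StrongDual ℂ E, Tendsto (fun a => y (f a)) l (𝓝 (y x)) :=
  WeakBilin.tendsto_iff_forall_eval_tendsto (topDualPairing ℂ E).flip
    (separatingDual_iff_injective.1 inferInstance)

namespace ContinuousLinearMapWOT

theorem tendsto_iff_forall_tendsto_toWeakSpace {α : Type*} {l : Filter α}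
    {f : α → E →WOT[ℂ] E} {A : E →WOT[ℂ] E} :
    Tendsto f l (𝓝 A) ↔
      ∀ x, Tendsto (fun a => toWeakSpace ℂ E (f a x)) l (𝓝 (toWeakSpace ℂ E (A x))) := by
  simp only [tendsto_iff_forall_dual_apply_tendsto, tendsto_toWeakSpace_iff]

/-- Places the operators inside a product of weak spaces, where Tychonoff's theorem applies. -/
theorem isInducing_toWeakSpace :
    IsInducing fun (A : E →WOT[ℂ] E) (x : E) => toWeakSpace ℂ E (A x) := by
  refine isInducing_iff_nhds.2 fun A => le_antisymm ?_ ?_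
  · refine Tendsto.le_comap (tendsto_pi_nhds.2 ?_)
    exact tendsto_iff_forall_tendsto_toWeakSpace.1 tendsto_id
  · exact tendsto_iff_forall_tendsto_toWeakSpace.2 (tendsto_pi_nhds.1 tendsto_comap)

/-- By Mazur, a norm-closed convex set is weakly closed. Norm bounds and membership in closed
subspaces thus pass to weak operator limits. -/
theorem isClosed_setOf_apply_mem {C : Set E} (hC : IsClosed C) (hconv : Convex ℝ C) (x : E) :
    IsClosed {A : E →WOT[ℂ] E | A x ∈ C} := by
  have h : IsClosed (toWeakSpace ℂ E '' C) := by
    rw [← hC.closure_eq, hconv.toWeakSpace_closure ℂ]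
    exact isClosed_closure
  convert h.preimage ((continuous_apply x).comp isInducing_toWeakSpace.continuous) using 1
  ext A
  simp

end ContinuousLinearMapWOT

end WeakTopology

/-! ### The compact semigroup 𝒯 -/

namespace BoundedC0Semigroup

variable {X : Type*} [NormedAddCommGroup X] [NormedSpace ℂ X] (T : BoundedC0Semigroup X)

open ContinuousLinearMapWOT

theorem exists_nonneg_bound : ∃ M : ℝ, 0 ≤ M ∧ ∀ t x, ‖T.op t x‖ ≤ M * ‖x‖ := by
  obtain ⟨M, hM⟩ := T.bounded
  exact ⟨M, (norm_nonneg _).trans (hM 0), fun t x => (T.op t).le_of_opNorm_le (hM t) x⟩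

theorem continuous_op_apply (x : X) : Continuous fun t => T.op t x := by
  obtain ⟨M, hM0, hM⟩ := T.exists_nonneg_bound
  -- With truncated subtraction, (s - t) + (t - s) is |s - t|.
  have key : ∀ s t : ℝ≥0, ‖T.op s x - T.op t x‖ ≤ M * ‖T.op ((s - t) + (t - s)) x - x‖ := by
    have aux : ∀ s t : ℝ≥0, s ≤ t → ‖T.op t x - T.op s x‖ ≤ M * ‖T.op (t - s) x - x‖ := by
      intro s t h
      have : T.op t x - T.op s x = T.op s (T.op (t - s) x - x) := by
        rw [map_sub, ← ContinuousLinearMap.comp_apply, ← T.op_add, add_tsub_cancel_of_le h]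
      rw [this]
      exact hM _ _
    intro s t
    rcases le_total s t with h | h
    · rw [norm_sub_rev, tsub_eq_zero_of_le h, zero_add]
      exact aux s t h
    · rw [tsub_eq_zero_of_le h, add_zero]
      exact aux t s h
  refine continuous_iff_continuousAt.2 fun t => tendsto_iff_norm_sub_tendsto_zero.2 ?_
  refine squeeze_zero (fun _ => norm_nonneg _) (fun s => key s t) ?_
  have h1 : Tendsto (fun s : ℝ≥0 => (s - t) + (t - s)) (𝓝 t) (𝓝 0) := by
    have : Continuous fun s : ℝ≥0 => (s - t) + (t - s) := by fun_prop
    simpa using this.tendsto t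
  simpa using ((tendsto_iff_norm_sub_tendsto_zero.1 ((T.tendsto_zero x).comp h1))).const_mul M

/-- The closure of `{T(t)}` as a set of operators with the weak operator topology. -/
def wotClosure : Set (X →WOT[ℂ] X) := closure (range fun t => ofCLM (T.op t))

variable {T}

theorem ofCLM_op_mem_wotClosure (t : ℝ≥0) : ofCLM (T.op t) ∈ T.wotClosure :=
  subset_closure ⟨t, rfl⟩

theorem one_mem_wotClosure : 1 ∈ T.wotClosure := by
  have := T.ofCLM_op_mem_wotClosure 0
  rwa [T.op_zero] at this

theorem ofCLM_op_mul (s t : ℝ≥0) : (ofCLM (T.op s) * ofCLM (T.op t) : X →WOT[ℂ] X)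
    = ofCLM (T.op (s + t)) := by
  rw [T.op_add]; rfl

/-- The product is only separately continuous, so commutativity is extended to the closure one
factor at a time. -/
theorem wotClosure_mul_comm {R S : X →WOT[ℂ] X} (hR : R ∈ T.wotClosure) (hS : S ∈ T.wotClosure) :
    R * S = S * R := by
  have h1 : ∀ t, T.wotClosure ⊆ {A | A * ofCLM (T.op t) = ofCLM (T.op t) * A} := fun t => by
    refine closure_minimal ?_
      (isClosed_eq (continuous_mul_const _) (continuous_const_mul _))
    rintro _ ⟨s, rfl⟩
    simp only [mem_ofPred_eq, ofCLM_op_mul, add_comm]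
  have h2 : T.wotClosure ⊆ {A | R * A = A * R} := by
    refine closure_minimal ?_
      (isClosed_eq (continuous_const_mul _) (continuous_mul_const _))
    rintro _ ⟨s, rfl⟩
    exact h1 s hR
  exact h2 hS

theorem mul_mem_wotClosure {R S : X →WOT[ℂ] X} (hR : R ∈ T.wotClosure) (hS : S ∈ T.wotClosure) :
    R * S ∈ T.wotClosure := by
  have h1 : ∀ t, ofCLM (T.op t) * S ∈ T.wotClosure := fun t => by
    refine map_mem_closure (continuous_const_mul _) hS ?_
    rintro _ ⟨s, rfl⟩
    exact ⟨t + s, (ofCLM_op_mul t s).symm⟩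
  have := map_mem_closure (t := T.wotClosure) (continuous_mul_const S) hR
    (by rintro _ ⟨s, rfl⟩; exact h1 s)
  rwa [wotClosure, closure_closure] at this

theorem norm_apply_le_of_mem_wotClosure {M : ℝ} (hM : ∀ t x, ‖T.op t x‖ ≤ M * ‖x‖)
    {S : X →WOT[ℂ] X} (hS : S ∈ T.wotClosure) (x : X) : ‖S x‖ ≤ M * ‖x‖ := by
  have : T.wotClosure ⊆ {A | A x ∈ Metric.closedBall 0 (M * ‖x‖)} := by
    refine closure_minimal ?_
      (isClosed_setOf_apply_mem Metric.isClosed_closedBall (convex_closedBall _ _) x)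
    rintro _ ⟨t, rfl⟩
    simpa using hM t x
  simpa using this hS

/-- Tychonoff gives compactness in the product of the weak orbit closures. It descends to operators
because every pointwise weak limit of the T(t) is linear and inherits the bound M. -/
theorem isCompact_wotClosure (hT : T.IsEberleinWAP) : IsCompact T.wotClosure := by
  set Φ := fun (A : X →WOT[ℂ] X) (x : X) => toWeakSpace ℂ X (A x) with hΦ
  have hind : IsInducing Φ := isInducing_toWeakSpace
  have hcpt : IsCompact (closure (Φ '' range fun t => ofCLM (T.op t))) := by
    refine (isCompact_univ_pi hT).of_isClosed_subset isClosed_closure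
      (closure_minimal ?_ (isClosed_set_pi fun _ _ => isClosed_closure))
    rintro _ ⟨_, ⟨t, rfl⟩, rfl⟩ x -
    exact subset_closure ⟨t, rfl⟩
  rw [hind.isCompact_iff, wotClosure, hind.closure_eq_preimage_closure_image,
    image_preimage_eq_of_subset]
  · exact hcpt
  obtain ⟨M, hM0, hM⟩ := T.exists_nonneg_bound
  intro φ hφ
  rw [← range_comp] at hφ
  obtain ⟨u, hu⟩ : ∃ F : Filter ℝ≥0, F.NeBot ∧
      Tendsto (fun t => Φ (ofCLM (T.op t))) F (𝓝 φ) := by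
    refine ⟨comap (fun t => Φ (ofCLM (T.op t))) (𝓝 φ), ?_, tendsto_comap⟩
    rw [comap_neBot_iff]
    intro s hs
    obtain ⟨_, h, t, rfl⟩ := mem_closure_iff_nhds.1 hφ s hs
    exact ⟨t, h⟩
  have := hu.1
  let ψ : X → X := fun x => (toWeakSpace ℂ X).symm (φ x)
  have hlim : ∀ x, Tendsto (fun t => toWeakSpace ℂ X (T.op t x)) u (𝓝 (toWeakSpace ℂ X (ψ x))) := by
    intro x
    exact tendsto_pi_nhds.1 hu.2 x
  have hy : ∀ x (y : StrongDual ℂ X), Tendsto (fun t => y (T.op t x)) u (𝓝 (y (ψ x))) :=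
    fun x => tendsto_toWeakSpace_iff.1 (hlim x)
  let L : X →ₗ[ℂ] X :=
    { toFun := ψ
      map_add' := fun x z => (SeparatingDual.eq_iff_forall_dual_eq (R := ℂ)).2 fun y =>
        tendsto_nhds_unique (hy (x + z) y) (by simpa using (hy x y).add (hy z y))
      map_smul' := fun c x => (SeparatingDual.eq_iff_forall_dual_eq (R := ℂ)).2 fun y =>
        tendsto_nhds_unique (hy (c • x) y) (by simpa using (hy x y).const_mul c) }
  refine ⟨ofCLM (L.mkContinuous M fun x => ?_), funext fun x => ?_⟩
  · refine NormedSpace.norm_le_dual_bound ℂ _ (by positivity) fun y => ?_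
    refine le_of_tendsto (hy x y).norm (Eventually.of_forall fun t => ?_)
    calc ‖y (T.op t x)‖ ≤ ‖y‖ * ‖T.op t x‖ := y.le_opNorm _
      _ ≤ ‖y‖ * (M * ‖x‖) := by gcongr; exact hM t x
      _ = M * ‖x‖ * ‖y‖ := mul_comm _ _
  · simp [Φ, L, ψ]

theorem exists_tendsto_of_mem_wotClosure {S : X →WOT[ℂ] X} (hS : S ∈ T.wotClosure) :
    ∃ F : Filter ℝ≥0, F.NeBot ∧ Tendsto (fun t => ofCLM (T.op t)) F (𝓝 S) := by
  refine ⟨comap (fun t => ofCLM (T.op t)) (𝓝 S), ?_, tendsto_comap⟩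
  rw [comap_neBot_iff]
  intro s hs
  obtain ⟨_, h, t, rfl⟩ := mem_closure_iff_nhds.1 hS s hs
  exact ⟨t, h⟩

/-- Lets any net of times be refined until T(t) itself converges, so that limits of single orbits
come from elements of 𝒯. -/
theorem exists_ultrafilter_tendsto (hT : T.IsEberleinWAP) (F : Filter ℝ≥0) [F.NeBot] :
    ∃ u : Ultrafilter ℝ≥0, ↑u ≤ F ∧ ∃ S ∈ T.wotClosure,
      Tendsto (fun t => ofCLM (T.op t)) u (𝓝 S) := by
  obtain ⟨S, hS, h⟩ := (isCompact_wotClosure hT).ultrafilter_le_nhds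
    ((Ultrafilter.of F).map fun t => ofCLM (T.op t))
    (le_principal_iff.2 (Ultrafilter.mem_map.2
      (Eventually.of_forall fun t => T.ofCLM_op_mem_wotClosure t)))
  exact ⟨Ultrafilter.of F, Ultrafilter.of_le F, S, hS, h⟩

variable (T) in
/-- `V` is the unit of a group `V𝒯`. -/
structure IsKernelUnit (V : X →WOT[ℂ] X) : Prop where
  mem : V ∈ T.wotClosure
  idem : V * V = V
  exists_inv : ∀ S ∈ T.wotClosure, ∃ R ∈ T.wotClosure, V * S * R = V

theorem exists_isKernelUnit (hT : T.IsEberleinWAP) : ∃ V, T.IsKernelUnit V := by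
  obtain ⟨V, h1, h2, h3⟩ := exists_idempotent_forall_exists_mul_eq (isCompact_wotClosure hT)
    one_mem_wotClosure (fun _ ha _ hb => mul_mem_wotClosure ha hb)
    (fun _ ha _ hb => wotClosure_mul_comm ha hb)
  exact ⟨V, h1, h2, h3⟩

end BoundedC0Semigroup

/-! ### Flight vectors and almost periodic vectors in X -/

namespace BoundedC0Semigroup

variable {X : Type*} [NormedAddCommGroup X] [NormedSpace ℂ X] {T : BoundedC0Semigroup X}

open ContinuousLinearMapWOT

/-- A refinement of the net gives S ∈ 𝒯 with Sx = 0, and V = (VR)S for some R. Conversely V is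
itself a limit of the T(t). -/
theorem mem_flightVectors_iff (hT : T.IsEberleinWAP) {V : X →WOT[ℂ] X} (hV : T.IsKernelUnit V)
    (x : X) : x ∈ T.flightVectors ↔ V x = 0 := by
  constructor
  · rintro ⟨F, hF, h⟩
    obtain ⟨u, hu, S, hS, hSu⟩ := exists_ultrafilter_tendsto hT F
    have h0 : S x = 0 := (toWeakSpace ℂ X).injective <|
      tendsto_nhds_unique (tendsto_iff_forall_tendsto_toWeakSpace.1 hSu x) (h.mono_left hu)
    obtain ⟨R, hR, hVR⟩ := hV.exists_inv S hS
    rw [mul_assoc, wotClosure_mul_comm hS hR, ← mul_assoc] at hVR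
    rw [← hVR, mul_apply, h0, map_zero]
  · intro h
    obtain ⟨F, hF, hFV⟩ := exists_tendsto_of_mem_wotClosure hV.mem
    refine ⟨F, hF, ?_⟩
    have := tendsto_iff_forall_tendsto_toWeakSpace.1 hFV x
    rwa [h] at this

/-- The closed span of the orbit is separable, as the orbit is a continuous image of [0, ∞), and it
is weakly closed, so it contains Sx. -/
theorem isSeparable_wotClosure_apply (x : X) :
    TopologicalSpace.IsSeparable ((fun S : X →WOT[ℂ] X => S x) '' T.wotClosure) := by
  set C : Submodule ℂ X := (Submodule.span ℂ (range fun t => T.op t x)).topologicalClosure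
  have hsep : TopologicalSpace.IsSeparable (C : Set X) :=
    (TopologicalSpace.isSeparable_range (T.continuous_op_apply x)).span.closure
  refine hsep.mono ?_
  have hconv : Convex ℝ (C : Set X) := (C.restrictScalars ℝ).convex
  rintro _ ⟨S, hS, rfl⟩
  have : T.wotClosure ⊆ {A | A x ∈ (C : Set X)} := by
    refine closure_minimal ?_
      (isClosed_setOf_apply_mem (Submodule.isClosed_topologicalClosure _) hconv x)
    rintro _ ⟨t, rfl⟩
    exact Submodule.le_topologicalClosure _ (Submodule.subset_span ⟨t, rfl⟩)
  exact this hS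

variable (T) in
/-- The group `V𝒯`. -/
def kernelGroup (V : X →WOT[ℂ] X) : Set (X →WOT[ℂ] X) := {S | S ∈ T.wotClosure ∧ V * S = S}

theorem IsKernelUnit.mul_mem {V S : X →WOT[ℂ] X} (hV : T.IsKernelUnit V)
    (hS : S ∈ T.wotClosure) : V * S ∈ T.kernelGroup V :=
  ⟨mul_mem_wotClosure hV.mem hS, by rw [← mul_assoc, hV.idem]⟩

theorem isCompact_kernelGroup (hT : T.IsEberleinWAP) (V : X →WOT[ℂ] X) :
    IsCompact (T.kernelGroup V) :=
  (isCompact_wotClosure hT).inter_right (isClosed_eq (continuous_const_mul V) continuous_id)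

/-- Baire category: somewhere on the group `V𝒯` the orbit map of `x` oscillates by at most `2ε`. -/
theorem exists_isOpen_dist_apply_le (hT : T.IsEberleinWAP) {V : X →WOT[ℂ] X}
    (hV : T.IsKernelUnit V) (x : X) {ε : ℝ} (hε : 0 < ε) :
    ∃ O : Set (X →WOT[ℂ] X), IsOpen O ∧ (O ∩ T.kernelGroup V).Nonempty ∧
      ∀ A ∈ O ∩ T.kernelGroup V, ∀ B ∈ O ∩ T.kernelGroup V, ‖A x - B x‖ ≤ 2 * ε := by
  obtain ⟨c, hc, hcd⟩ := isSeparable_wotClosure_apply (T := T) x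
  have : CompactSpace (T.kernelGroup V) :=
    isCompact_iff_compactSpace.1 (isCompact_kernelGroup hT V)
  have : Nonempty (T.kernelGroup V) := ⟨⟨V, hV.mem, hV.idem⟩⟩
  have : Countable c := hc.to_subtype
  -- Countably many closed conditions Ax ∈ B(d, ε) cover a compact Hausdorff space, so one of them
  -- has interior.
  obtain ⟨d, hd⟩ := nonempty_interior_of_iUnion_of_closed
    (f := fun d : c => {A : T.kernelGroup V | A.1 x ∈ Metric.closedBall d.1 ε})
    (fun d => (isClosed_setOf_apply_mem Metric.isClosed_closedBall
      (convex_closedBall d.1 ε) x).preimage continuous_subtype_val) (by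
        refine eq_univ_of_forall fun A => mem_iUnion.2 ?_
        obtain ⟨d, hd, h⟩ := Metric.mem_closure_iff.1 (hcd ⟨A.1, A.2.1, rfl⟩) ε hε
        exact ⟨⟨d, hd⟩, h.le⟩)
  obtain ⟨O, hO, hOi⟩ := isOpen_induced_iff.1 (isOpen_interior
    (s := {A : T.kernelGroup V | A.1 x ∈ Metric.closedBall d.1 ε}))
  have hball : ∀ A ∈ O ∩ T.kernelGroup V, dist (A x) d ≤ ε := fun A hA => by
    have h := hOi.subset (show (⟨A, hA.2⟩ : T.kernelGroup V) ∈ Subtype.val ⁻¹' O from hA.1)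
    have h2 := interior_subset (s := {A : T.kernelGroup V | A.1 x ∈ Metric.closedBall d.1 ε}) h
    exact h2
  obtain ⟨A, hA⟩ := hd
  refine ⟨O, hO, ⟨A, hOi.symm.subset hA, A.2⟩, fun A hA B hB => ?_⟩
  rw [← dist_eq_norm]
  linarith [dist_triangle_right (A x) (B x) d, hball A hA, hball B hB]

/-- On the group `V𝒯` the weak and the strong operator topologies agree. -/
theorem continuousOn_kernelGroup_apply (hT : T.IsEberleinWAP) {V : X →WOT[ℂ] X}
    (hV : T.IsKernelUnit V) (x : X) :
    ContinuousOn (fun S : X →WOT[ℂ] X => S x) (T.kernelGroup V) := by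
  obtain ⟨M, hM0, hM⟩ := T.exists_nonneg_bound
  intro R hR
  refine Metric.tendsto_nhds.2 fun ε hε => ?_
  -- Small oscillation near A is transported to R: multiplication by R'A carries R to A, and A'R
  -- undoes it on the group with norm at most M. The resulting oscillation 2Mε/(4(M+1)) is at most
  -- ε/2.
  obtain ⟨O, hO, ⟨A, hAO, hA⟩, hOd⟩ :=
    exists_isOpen_dist_apply_le hT hV x (ε := ε / (4 * (M + 1))) (by positivity)
  obtain ⟨R', hR', hRR⟩ := hV.exists_inv R hR.1
  obtain ⟨A', hA', hAA⟩ := hV.exists_inv A hA.1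
  have hW : R' * A ∈ T.wotClosure := mul_mem_wotClosure hR' hA.1
  have hW' : A' * R ∈ T.wotClosure := mul_mem_wotClosure hA' hR.1
  have hRW : R * (R' * A) = A := by
    rw [← mul_assoc, ← hR.2, hRR, hA.2]
  have hcancel : ∀ S ∈ T.kernelGroup V, A' * R * (S * (R' * A)) = S := fun S hS => by
    calc A' * R * (S * (R' * A)) = A' * (R * S) * (R' * A) := by simp only [mul_assoc]
      _ = A' * (S * R) * (R' * A) := by rw [wotClosure_mul_comm hR.1 hS.1]
      _ = A' * S * (R * (R' * A)) := by simp only [mul_assoc]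
      _ = S * (A' * A) := by rw [hRW, wotClosure_mul_comm hA' hS.1, mul_assoc]
      _ = V * S * (A * A') := by rw [hS.2, wotClosure_mul_comm hA' hA.1]
      _ = S * (V * (A * A')) := by rw [wotClosure_mul_comm hV.mem hS.1, mul_assoc]
      _ = S := by rw [← mul_assoc V, hAA, wotClosure_mul_comm hS.1 hV.mem, hS.2]
  have hmem : ∀ S ∈ T.kernelGroup V, S * (R' * A) ∈ T.kernelGroup V := fun S hS =>
    ⟨mul_mem_wotClosure hS.1 hW, by rw [← mul_assoc, hS.2]⟩
  have hnhds : ∀ᶠ S in 𝓝[T.kernelGroup V] R, S * (R' * A) ∈ O :=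
    mem_nhdsWithin_of_mem_nhds ((hO.preimage (continuous_mul_const (R' * A))).mem_nhds
      (by rwa [mem_preimage, hRW]))
  filter_upwards [hnhds, self_mem_nhdsWithin] with S hSO hS
  have h1 := hOd _ ⟨hSO, hmem S hS⟩ _ ⟨(by rwa [hRW] : R * (R' * A) ∈ O), hmem R hR⟩
  rw [dist_eq_norm]
  calc ‖S x - R x‖ = ‖(A' * R) ((S * (R' * A)) x - (R * (R' * A)) x)‖ := by
        rw [map_sub, ← mul_apply (A' * R), ← mul_apply (A' * R), hcancel S hS, hcancel R hR]
    _ ≤ M * (2 * (ε / (4 * (M + 1)))) :=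
        (norm_apply_le_of_mem_wotClosure hM hW' _).trans (by gcongr)
    _ ≤ (M + 1) * (2 * (ε / (4 * (M + 1)))) := by gcongr; linarith
    _ = ε / 2 := by field_simp; norm_num
    _ < ε := half_lt_self hε

theorem isCompact_kernelGroup_apply (hT : T.IsEberleinWAP) {V : X →WOT[ℂ] X}
    (hV : T.IsKernelUnit V) (x : X) :
    IsCompact ((fun S : X →WOT[ℂ] X => S x) '' T.kernelGroup V) :=
  (isCompact_kernelGroup hT V).image_of_continuousOn (continuousOn_kernelGroup_apply hT hV x)

/-- The semigroup `T(t)V` extends to a group indexed by `ℝ`. -/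
theorem exists_group_extension {V : X →WOT[ℂ] X} (hV : T.IsKernelUnit V) (r : ℝ) :
    ∃ S ∈ T.kernelGroup V, ∀ a b : ℝ≥0, (b : ℝ) - a = r →
      ofCLM (T.op a) * S = V * ofCLM (T.op b) := by
  -- With r = r⁺ - r⁻, the operator at time r is V T(r⁺) times the inverse of V T(r⁻) in V𝒯.
  obtain ⟨R, hR, hVR⟩ := hV.exists_inv _ (T.ofCLM_op_mem_wotClosure (-r).toNNReal)
  have hop := fun t => T.ofCLM_op_mem_wotClosure t
  refine ⟨V * (ofCLM (T.op r.toNNReal) * R), hV.mul_mem (mul_mem_wotClosure (hop _) hR),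
    fun a b hab => ?_⟩
  have hsum : a + r.toNNReal = b + (-r).toNNReal := by
    rw [← NNReal.coe_inj, NNReal.coe_add, NNReal.coe_add, Real.coe_toNNReal', Real.coe_toNNReal']
    rcases le_total 0 r with h | h
    · rw [max_eq_left h, max_eq_right (by linarith)]; linarith
    · rw [max_eq_right h, max_eq_left (by linarith)]; linarith
  calc ofCLM (T.op a) * (V * (ofCLM (T.op r.toNNReal) * R))
      = V * (ofCLM (T.op a) * ofCLM (T.op r.toNNReal)) * R := by
        rw [← mul_assoc, wotClosure_mul_comm (hop a) hV.mem]; simp only [mul_assoc]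
    _ = V * (ofCLM (T.op (-r).toNNReal) * ofCLM (T.op b)) * R := by
        rw [ofCLM_op_mul, hsum, add_comm, ofCLM_op_mul]
    _ = V * ofCLM (T.op (-r).toNNReal) * R * ofCLM (T.op b) := by
        rw [mul_assoc, mul_assoc, wotClosure_mul_comm (hop b) hR]; simp only [mul_assoc]
    _ = V * ofCLM (T.op b) := by rw [hVR]

theorem eq_of_op_mul_eq {V : X →WOT[ℂ] X} (hV : T.IsKernelUnit V) {S S' : X →WOT[ℂ] X}
    (hS : S ∈ T.kernelGroup V) (hS' : S' ∈ T.kernelGroup V) (a : ℝ≥0)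
    (h : ofCLM (T.op a) * S = ofCLM (T.op a) * S') : S = S' := by
  obtain ⟨R, hR, hVR⟩ := hV.exists_inv _ (T.ofCLM_op_mem_wotClosure a)
  rw [mul_assoc, wotClosure_mul_comm (T.ofCLM_op_mem_wotClosure a) hR, ← mul_assoc] at hVR
  rw [← hS.2, ← hS'.2, ← hVR, mul_assoc, mul_assoc (V * R), h]

/-- `V X ⊆ X_ap`. -/
theorem apply_mem_almostPeriodicVectors (hT : T.IsEberleinWAP) {V : X →WOT[ℂ] X}
    (hV : T.IsKernelUnit V) {x : X} (hx : V x = x) : x ∈ T.almostPeriodicVectors := by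
  obtain ⟨M, hM0, hM⟩ := T.exists_nonneg_bound
  choose U hU hop using exists_group_extension hV
  have hadd : ∀ r s, U (r + s) = U r * U s := fun r s => by
    -- Multiplying by T(r⁻ + s⁻) moves both sides to nonnegative times, where the semigroup law
    -- applies.
    refine eq_of_op_mul_eq hV (hU _)
      ⟨mul_mem_wotClosure (hU r).1 (hU s).1, by rw [← mul_assoc, (hU r).2]⟩
      ((-r).toNNReal + (-s).toNNReal) ?_
    have haux : ∀ r : ℝ, ((r.toNNReal : ℝ≥0) : ℝ) - ((-r).toNNReal : ℝ≥0) = r := fun r => by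
      rw [Real.coe_toNNReal', Real.coe_toNNReal']
      rcases le_total 0 r with h | h
      · rw [max_eq_left h, max_eq_right (by linarith)]; linarith
      · rw [max_eq_right h, max_eq_left (by linarith)]; linarith
    have hm := fun t => T.ofCLM_op_mem_wotClosure t
    rw [hop (r + s) _ (r.toNNReal + s.toNNReal) (by
      have := haux r; have := haux s; push_cast; linarith), ← ofCLM_op_mul, ← ofCLM_op_mul]
    calc V * (ofCLM (T.op r.toNNReal) * ofCLM (T.op s.toNNReal))
        = V * ofCLM (T.op r.toNNReal) * (V * ofCLM (T.op s.toNNReal)) := by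
          rw [mul_assoc V, ← mul_assoc _ V, wotClosure_mul_comm (hm r.toNNReal) hV.mem,
            ← mul_assoc V, ← mul_assoc V, ← mul_assoc V, hV.idem, mul_assoc]
      _ = ofCLM (T.op (-r).toNNReal) * U r * (ofCLM (T.op (-s).toNNReal) * U s) := by
          rw [hop r _ _ (haux r), hop s _ _ (haux s)]
      _ = ofCLM (T.op (-r).toNNReal) * ofCLM (T.op (-s).toNNReal) * (U r * U s) := by
          rw [mul_assoc, ← mul_assoc (U r), wotClosure_mul_comm (hU r).1 (hm _)]
          simp only [mul_assoc]
  have hcont : ∀ y, Continuous fun r => U r y := fun y => by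
    refine continuous_iff_continuousAt.2 fun r => ?_
    -- Shifting by |r| + 1 makes times near r positive, so U inherits continuity from the orbits of
    -- T.
    have heq : ∀ᶠ q in 𝓝 r, (U (-(|r| + 1))).toCLM (V (T.op (q + (|r| + 1)).toNNReal y)) = U q y := by
      filter_upwards [eventually_gt_nhds (show -(|r| + 1) < r by linarith [neg_abs_le r])] with q hq
      have h1 : U (q + (|r| + 1)) = V * ofCLM (T.op (q + (|r| + 1)).toNNReal) := by
        rw [← hop (q + (|r| + 1)) 0 _ (by
          rw [Real.coe_toNNReal _ (by linarith), NNReal.coe_zero, sub_zero]), T.op_zero]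
        exact (one_mul _).symm
      have h2 : U q = U (-(|r| + 1)) * U (q + (|r| + 1)) := by
        rw [← hadd]; congr 1; ring
      rw [h2, h1]; rfl
    refine ContinuousAt.congr ?_ heq
    have : Continuous fun q : ℝ =>
        (U (-(|r| + 1))).toCLM (V.toCLM (T.op (q + (|r| + 1)).toNNReal y)) :=
      ((U (-(|r| + 1))).toCLM.comp V.toCLM).continuous.comp ((T.continuous_op_apply y).comp
        (continuous_real_toNNReal.comp (continuous_id.add continuous_const)))
    exact this.continuousAt
  have hbd : ∀ r y, ‖U r y‖ ≤ M * ‖y‖ := fun r y => norm_apply_le_of_mem_wotClosure hM (hU r).1 y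
  let Ψ : X → (ℝ →ᵇ X) := fun y =>
    BoundedContinuousFunction.ofNormedAddCommGroup (fun r => U r y) (hcont y) _ fun r => hbd r y
  have hΨ : LipschitzWith ⟨M, hM0⟩ Ψ := by
    refine LipschitzWith.of_dist_le_mul fun y z => ?_
    refine (BoundedContinuousFunction.dist_le (by positivity)).2 fun r => ?_
    simp only [Ψ, BoundedContinuousFunction.coe_ofNormedAddCommGroup, dist_eq_norm, ← map_sub]
    exact hbd r _
  refine ⟨Ψ x, ((isCompact_kernelGroup_apply hT hV x).image
    hΨ.continuous).closure_of_subset ?_, fun t => ?_⟩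
  -- The translate of Ψ x by h is Ψ (U h x), so all translates lie in the image under Ψ of the
  -- compact set (V𝒯)x.
  · rintro _ ⟨h, rfl⟩
    refine ⟨_, ⟨U h, hU h, rfl⟩, ?_⟩
    ext r
    simp [Ψ, hadd]
  · have h0 := hop t 0 t (by simp)
    rw [T.op_zero] at h0
    have h1 : U t = ofCLM (T.op t) * V := by
      rw [wotClosure_mul_comm (T.ofCLM_op_mem_wotClosure t) hV.mem, ← h0]
      exact (one_mul _).symm
    simp [Ψ, h1, hx]

/-- If T(s)x ≈ Vx and T(ks + s)x ≈ x, then T(ks)Vx ≈ x. Since T(ks)Vx lies in the closed space VX,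
so does x. -/
theorem apply_eq_of_mem_almostPeriodicVectors {V : X →WOT[ℂ] X}
    (hV : T.IsKernelUnit V) {x : X} (hx : x ∈ T.almostPeriodicVectors) : V x = x := by
  obtain ⟨M, hM0, hM⟩ := T.exists_nonneg_bound
  obtain ⟨f, hf, hfx⟩ := hx
  have hclosed : IsClosed {y | V y = y} := isClosed_eq V.toCLM.continuous continuous_id
  refine hclosed.closure_subset (Metric.mem_closure_iff.2 fun ε hε => ?_)
  obtain ⟨δ, hδ, hδε⟩ : ∃ δ > 0, M * δ + δ < ε :=
    ⟨ε / (2 * (M + 1)), by positivity, by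
      rw [show M * (ε / (2 * (M + 1))) + ε / (2 * (M + 1)) = ε / 2 by field_simp]
      exact half_lt_self hε⟩
  set τ : ℝ → (ℝ →ᵇ X) := fun h => f.compContinuous (ContinuousMap.addRight h) with hτ
  -- a norm approximation of `V x` by the orbit of `x`
  obtain ⟨s, hs⟩ : ∃ s, ‖T.op s x - V x‖ < δ := by
    obtain ⟨F, hF, hFV⟩ := exists_tendsto_of_mem_wotClosure hV.mem
    obtain ⟨g, -, hg⟩ := hf.ultrafilter_le_nhds ((Ultrafilter.of F).map fun t : ℝ≥0 => τ t)
      (le_principal_iff.2 (Ultrafilter.mem_map.2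
        (Eventually.of_forall fun t => subset_closure ⟨(t : ℝ), rfl⟩)))
    have hg' : Tendsto (fun t : ℝ≥0 => τ t) (Ultrafilter.of F) (𝓝 g) := hg
    have h1 : Tendsto (fun t => T.op t x) (Ultrafilter.of F) (𝓝 (g 0)) := by
      have := ((BoundedContinuousFunction.lipschitz_eval_const (0 : ℝ)).continuous.tendsto g).comp hg'
      refine this.congr fun t => ?_
      simp [hτ, hfx]
    have h2 : V x = g 0 := (toWeakSpace ℂ X).injective <| tendsto_nhds_unique
      ((tendsto_iff_forall_tendsto_toWeakSpace.1 hFV x).mono_left (Ultrafilter.of_le F))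
      (((toWeakSpaceCLM ℂ X).continuous.tendsto _).comp h1)
    rw [← h2] at h1
    simp only [← dist_eq_norm]
    exact ((Metric.tendsto_nhds.1 h1) δ hδ).exists
  -- a return of the orbit to `x`
  obtain ⟨k, hk⟩ : ∃ k : ℕ, ‖T.op (k * s + s) x - x‖ < δ := by
    -- Two translates by distinct multiples of s are uniformly close. Evaluating at the negative
    -- time -φ(N)s compares x with T((m + 1)s)x; writing the gap as m + 1 leaves one step s to be
    -- replaced by V.
    obtain ⟨a, -, φ, hφ, hlim⟩ := hf.tendsto_subseq (x := fun n : ℕ => τ (n * s))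
      fun n => subset_closure ⟨_, rfl⟩
    obtain ⟨N, hN⟩ := Metric.cauchySeq_iff.1 hlim.cauchySeq δ hδ
    have h1 := hN (N + 1) (Nat.le_succ N) N le_rfl
    have hlt : φ N < φ (N + 1) := hφ (Nat.lt_succ_self N)
    obtain ⟨m, hm⟩ := Nat.exists_eq_add_of_lt hlt
    refine ⟨m, ?_⟩
    have h2 := (BoundedContinuousFunction.dist_coe_le_dist (-(φ N * s : ℝ))).trans_lt h1
    have h0 := hfx 0
    rw [T.op_zero] at h0
    simp only [Function.comp_apply, hτ, BoundedContinuousFunction.compContinuous_apply,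
      ContinuousMap.coe_addRight, neg_add_cancel] at h2
    have h3 : -(φ N * s : ℝ) + φ (N + 1) * s = ((m * s + s : ℝ≥0) : ℝ) := by
      rw [hm]; push_cast; ring
    rwa [h3, ← hfx, ← NNReal.coe_zero, ← h0, dist_eq_norm] at h2
  refine ⟨T.op (k * s) (V x), ?_, ?_⟩
  · change (V * ofCLM (T.op (k * s)) * V) x = _
    rw [wotClosure_mul_comm hV.mem (T.ofCLM_op_mem_wotClosure _), mul_assoc, hV.idem]
    rfl
  · rw [dist_eq_norm, norm_sub_rev]
    have h3 : T.op (k * s) (V x) - x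
        = T.op (k * s) (V x - T.op s x) + (T.op (k * s + s) x - x) := by
      rw [T.op_add]; simp
    rw [h3]
    refine (norm_add_le _ _).trans_lt (lt_of_le_of_lt ?_ hδε)
    gcongr
    refine (hM _ _).trans ?_
    rw [norm_sub_rev]
    gcongr

end BoundedC0Semigroup

/-! ### The sun-dual semigroup -/

namespace BoundedC0Semigroup

variable {X : Type*} [NormedAddCommGroup X] [NormedSpace ℂ X] {T : BoundedC0Semigroup X}

open ContinuousLinearMapWOT

theorem comp_mem_sunDual_of_comm {S : X →L[ℂ] X} (hS : ∀ t, S.comp (T.op t) = (T.op t).comp S)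
    {f : StrongDual ℂ X} (hf : f ∈ T.sunDual) : f.comp S ∈ T.sunDual := by
  have h : Tendsto (fun t => (f.comp (T.op t)).comp S) (𝓝 0) (𝓝 (f.comp S)) :=
    (((ContinuousLinearMap.compL ℂ X X ℂ).flip S).continuous.tendsto f).comp hf
  refine h.congr fun t => ?_
  rw [ContinuousLinearMap.comp_assoc, ← hS, ← ContinuousLinearMap.comp_assoc]

theorem comm_op_of_mem_wotClosure {S : X →WOT[ℂ] X} (hS : S ∈ T.wotClosure) (t : ℝ≥0) :
    S.toCLM.comp (T.op t) = (T.op t).comp S.toCLM :=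
  congrArg toCLM (wotClosure_mul_comm hS (T.ofCLM_op_mem_wotClosure t))

/-- `S^⊙`, the restriction of the adjoint of `S` to `X^⊙`, for `S ∈ 𝒯`. -/
noncomputable def sunRestrict (S : T.wotClosure) : T.sunDual →L[ℂ] T.sunDual :=
  (((ContinuousLinearMap.compL ℂ X X ℂ).flip S.1.toCLM).comp T.sunDual.subtypeL).codRestrict
    T.sunDual fun f => comp_mem_sunDual_of_comm (comm_op_of_mem_wotClosure S.2) f.2

theorem sunDual_ext {f g : T.sunDual} (h : ∀ x, (f : StrongDual ℂ X) x = (g : StrongDual ℂ X) x) :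
    f = g :=
  Subtype.ext (ContinuousLinearMap.ext h)

theorem sunRestrict_comm_op (S : T.wotClosure) (t : ℝ≥0) :
    (sunRestrict S).comp (T.sun.op t) = (T.sun.op t).comp (sunRestrict S) := by
  refine ContinuousLinearMap.ext fun f => sunDual_ext fun x => ?_
  exact congrArg (f : StrongDual ℂ X)
    (DFunLike.congr_fun (comm_op_of_mem_wotClosure S.2 t) x).symm

theorem tendsto_sunToWeakDual_iff {α : Type*} {l : Filter α} {f : α → T.sunDual} {g : T.sunDual} :
    Tendsto (fun a => T.sunToWeakDual (f a)) l (𝓝 (T.sunToWeakDual g)) ↔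
      ∀ x, Tendsto (fun a => (f a : StrongDual ℂ X) x) l (𝓝 ((g : StrongDual ℂ X) x)) :=
  tendsto_iff_forall_eval_tendsto_topDualPairing

theorem sunToWeakDual_injective : Function.Injective T.sunToWeakDual := fun _ _ h =>
  Subtype.ext (StrongDual.toWeakDual.injective h)

/-- Weak operator convergence tests x against all of X^*, in particular against X^⊙. -/
theorem tendsto_sun_op {F : Filter ℝ≥0} {S : X →WOT[ℂ] X} (hS : S ∈ T.wotClosure)
    (h : Tendsto (fun t => ofCLM (T.op t)) F (𝓝 S)) (f : T.sunDual) :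
    Tendsto (fun t => T.sunToWeakDual (T.sun.op t f)) F
      (𝓝 (T.sunToWeakDual (sunRestrict ⟨S, hS⟩ f))) :=
  tendsto_sunToWeakDual_iff.2 fun x => tendsto_iff_forall_dual_apply_tendsto.1 h x f

/-- The map S ↦ S^⊙ is continuous on the compact 𝒯, so its image is closed and contains the closure
of the T^⊙(t). Each S^⊙ is also a limit of them. -/
theorem mem_sunCompactification_iff (hT : T.IsEberleinWAP) (R : T.sunDual →L[ℂ] T.sunDual) :
    R ∈ T.sunCompactification ↔ ∃ S, sunRestrict S = R := by
  let Ψ : T.wotClosure → T.sunDual → WeakDual ℂ X := fun S f => T.sunToWeakDual (sunRestrict S f)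
  have hΨ : Continuous Ψ := by
    refine continuous_pi fun f => continuous_iff_continuousAt.2 fun S => ?_
    exact tendsto_sunToWeakDual_iff.2 fun x =>
      ((continuous_dual_apply x (f : StrongDual ℂ X)).comp continuous_subtype_val).tendsto S
  constructor
  · intro h
    have : CompactSpace T.wotClosure := isCompact_iff_compactSpace.1 (isCompact_wotClosure hT)
    obtain ⟨S, hS⟩ := closure_minimal (t := range Ψ) (by
      rintro _ ⟨t, rfl⟩
      exact ⟨⟨_, T.ofCLM_op_mem_wotClosure t⟩, rfl⟩) (isCompact_range hΨ).isClosed h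
    exact ⟨S, ContinuousLinearMap.ext fun f => sunToWeakDual_injective (congrFun hS f)⟩
  · rintro ⟨S, rfl⟩
    obtain ⟨F, hF, hFS⟩ := exists_tendsto_of_mem_wotClosure S.2
    exact mem_closure_of_tendsto (tendsto_pi_nhds.2 fun f => tendsto_sun_op S.2 hFS f)
      (Eventually.of_forall fun t => ⟨t, rfl⟩)

/-- Adjoints reverse products. -/
theorem sunRestrict_apply_eq {R S P : T.wotClosure} (h : R.1 * S.1 = P.1) (f : T.sunDual) :
    sunRestrict S (sunRestrict R f) = sunRestrict P f :=
  sunDual_ext fun x => congrArg (f : StrongDual ℂ X) (DFunLike.congr_fun h x)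

theorem mem_sunFlight_iff (hT : T.IsEberleinWAP) {V : X →WOT[ℂ] X} (hV : T.IsKernelUnit V)
    (f : T.sunDual) : f ∈ T.sunFlight ↔ sunRestrict ⟨V, hV.mem⟩ f = 0 := by
  constructor
  · rintro ⟨F, hF, h⟩
    obtain ⟨u, hu, S, hS, hSu⟩ := exists_ultrafilter_tendsto hT F
    have h0 : sunRestrict ⟨S, hS⟩ f = 0 := sunToWeakDual_injective <|
      tendsto_nhds_unique (tendsto_sun_op hS hSu f) (h.mono_left hu)
    obtain ⟨R, hR, hVR⟩ := hV.exists_inv S hS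
    rw [wotClosure_mul_comm hV.mem hS, mul_assoc] at hVR
    rw [← sunRestrict_apply_eq (R := ⟨S, hS⟩) (S := ⟨V * R, mul_mem_wotClosure hV.mem hR⟩) hVR, h0,
      map_zero]
  · intro h
    obtain ⟨F, hF, hFV⟩ := exists_tendsto_of_mem_wotClosure hV.mem
    refine ⟨F, hF, ?_⟩
    have := tendsto_sun_op hV.mem hFV f
    rwa [h] at this

theorem tendsto_sunToWeakDual_op {α : Type*} {l : Filter α} {f : α → T.sunDual} {g : T.sunDual}
    (h : Tendsto (fun a => T.sunToWeakDual (f a)) l (𝓝 (T.sunToWeakDual g))) (t : ℝ≥0) :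
    Tendsto (fun a => T.sunToWeakDual (T.sun.op t (f a))) l
      (𝓝 (T.sunToWeakDual (T.sun.op t g))) :=
  tendsto_sunToWeakDual_iff.2 fun x => tendsto_sunToWeakDual_iff.1 h (T.op t x)

/-- Reversibility along a net with T(s_α) → V yields f = (VR)^⊙f, which V^⊙ fixes. Conversely, if
V^⊙f = f and the orbit converges to z = S^⊙f, an inverse R of VS in V𝒯 gives R^⊙z = (VSR)^⊙f = f. -/
theorem mem_sunReversible_iff (hT : T.IsEberleinWAP) {V : X →WOT[ℂ] X} (hV : T.IsKernelUnit V)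
    (f : T.sunDual) : f ∈ T.sunReversible ↔ sunRestrict ⟨V, hV.mem⟩ f = f := by
  constructor
  · intro h
    obtain ⟨F, hF, hFV⟩ := exists_tendsto_of_mem_wotClosure hV.mem
    have hlim := tendsto_sun_op hV.mem hFV f
    obtain ⟨G, hG, g, hg, hGg⟩ := h F hF ⟨_, hlim⟩
    have hgt : ∀ t, g t = T.sun.op t (sunRestrict ⟨V, hV.mem⟩ f) := fun t =>
      sunToWeakDual_injective (tendsto_nhds_unique (hg t) (tendsto_sunToWeakDual_op hlim t))
    obtain ⟨u, hu, R, hR, hRu⟩ := exists_ultrafilter_tendsto hT G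
    have hf : f = sunRestrict ⟨R, hR⟩ (sunRestrict ⟨V, hV.mem⟩ f) := by
      refine sunToWeakDual_injective (tendsto_nhds_unique (hGg.mono_left hu) ?_)
      simp only [hgt]
      exact tendsto_sun_op hR hRu _
    have hf' : f = sunRestrict ⟨V * R, mul_mem_wotClosure hV.mem hR⟩ f := by
      rwa [sunRestrict_apply_eq (P := ⟨V * R, mul_mem_wotClosure hV.mem hR⟩) rfl] at hf
    conv_lhs => rw [hf']
    conv_rhs => rw [hf']
    refine sunRestrict_apply_eq ?_ f
    change V * R * V = V * R
    rw [mul_assoc, wotClosure_mul_comm hR hV.mem, ← mul_assoc, hV.idem]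
  · rintro h F hF ⟨z, hz⟩
    obtain ⟨u, hu, S, hS, hSu⟩ := exists_ultrafilter_tendsto hT F
    have hzS : z = sunRestrict ⟨S, hS⟩ f := sunToWeakDual_injective <|
      tendsto_nhds_unique (hz.mono_left hu) (tendsto_sun_op hS hSu f)
    obtain ⟨R, hR, hVR⟩ := hV.exists_inv S hS
    obtain ⟨G, hG, hGR⟩ := exists_tendsto_of_mem_wotClosure hR
    refine ⟨G, hG, fun t => T.sun.op t z, fun t => tendsto_sunToWeakDual_op hz t, ?_⟩
    have hlim := tendsto_sun_op hR hGR z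
    have hzf : sunRestrict ⟨R, hR⟩ z = f := by
      rw [hzS, ← h, sunRestrict_apply_eq (R := ⟨V, hV.mem⟩) (S := ⟨S, hS⟩)
      (P := ⟨V * S, mul_mem_wotClosure hV.mem hS⟩) rfl,
      sunRestrict_apply_eq (P := ⟨V, hV.mem⟩) hVR]
    rwa [hzf] at hlim

end BoundedC0Semigroup

/-! ### The projections and the splittings -/

theorem isCompl_range_ker_of_isIdempotentElem {E : Type*} [NormedAddCommGroup E] [NormedSpace ℂ E]
    {P : E →L[ℂ] E} (hP : IsIdempotentElem P) :
    (∀ x, x ∈ LinearMap.range P.toLinearMap ↔ P x = x) ∧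
    LinearMap.range (ContinuousLinearMap.id ℂ E - P).toLinearMap = LinearMap.ker P.toLinearMap ∧
    IsCompl (LinearMap.range P.toLinearMap) (LinearMap.ker P.toLinearMap) := by
  have hPP : ∀ x, P (P x) = P x := fun x => DFunLike.congr_fun hP x
  refine ⟨fun x => ⟨?_, fun h => ⟨x, h⟩⟩, ?_, ?_⟩
  · rintro ⟨y, rfl⟩
    exact hPP y
  · ext x
    constructor
    · rintro ⟨y, rfl⟩
      simp [hPP]
    · intro h
      exact ⟨x, by simpa using h⟩
  · rw [isCompl_iff, disjoint_iff_inf_le, codisjoint_iff_le_sup]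
    constructor
    · rintro _ ⟨⟨y, rfl⟩, h⟩
      have : P (P y) = 0 := h
      rw [hPP] at this
      exact this
    · intro x _
      exact Submodule.mem_sup.2 ⟨P x, ⟨x, rfl⟩, x - P x, by simp [hPP], by simp⟩

open BoundedC0Semigroup ContinuousLinearMapWOT in
theorem theorem7p4 {X : Type*} [NormedAddCommGroup X] [NormedSpace ℂ X] [CompleteSpace X]
    (T : BoundedC0Semigroup X) (hT : T.IsEberleinWAP) :
    ∃ (V : X →L[ℂ] X) (P : T.sunDual →L[ℂ] T.sunDual)
      (hV : T.sunEmbedding.comp V ∈ T.sunSunOperators),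
      -- the projection `V` and the splitting `X = X_ap ⊕ X_0`
      (IsIdempotentElem V ∧
        (LinearMap.range V.toLinearMap : Set X) = T.almostPeriodicVectors ∧
        (LinearMap.ker V.toLinearMap : Set X) = T.flightVectors ∧
        IsCompl (LinearMap.range V.toLinearMap) (LinearMap.ker V.toLinearMap)) ∧
      -- the minimal idempotents are unique, for either of the two orders
      ((∀ Q, IsMinimalIdempotent IdemLeL T.weakCompactification Q ↔ Q = V) ∧
        (∀ Q, IsMinimalIdempotent IdemLeR T.weakCompactification Q ↔ Q = V) ∧
        (∀ Q, IsMinimalIdempotent IdemLeL T.sunCompactification Q ↔ Q = P) ∧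
        (∀ Q, IsMinimalIdempotent IdemLeR T.sunCompactification Q ↔ Q = P)) ∧
      -- `X_a^⊙ = P X^⊙ = X_rev^⊙`, `X_0^⊙ = (I - P) X^⊙ = X_fl^⊙`, `X^⊙ = X_rev^⊙ ⊕ X_fl^⊙`
      (IsIdempotentElem P ∧
        (LinearMap.range P.toLinearMap : Set T.sunDual) = T.sunReversible ∧
        (LinearMap.range (ContinuousLinearMap.id ℂ T.sunDual - P).toLinearMap : Set T.sunDual) = T.sunFlight ∧
        IsCompl (LinearMap.range P.toLinearMap) (LinearMap.range (ContinuousLinearMap.id ℂ T.sunDual - P).toLinearMap)) ∧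
      -- the projection on the sun-dual is the image of `V`
      P = (T.eta ⟨T.sunEmbedding.comp V, hV⟩).1 := by
  obtain ⟨V, hV⟩ := exists_isKernelUnit hT
  set P := sunRestrict ⟨V, hV.mem⟩
  have hVV : IsIdempotentElem V.toCLM := congrArg toCLM hV.idem
  have hPP : IsIdempotentElem P := ContinuousLinearMap.ext fun f => sunRestrict_apply_eq hV.idem f
  -- The operator induced on X^⊙ is f ↦ f ∘ V, that is P. It commutes with T^⊙, so its adjoint
  -- preserves X^⊙⊙ by the argument for X^⊙ applied to the sun semigroup.
  have hjV : T.sunEmbedding.comp V.toCLM ∈ T.sunSunOperators :=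
    ⟨fun y => (P y).2, fun ξ hξ =>
      comp_mem_sunDual_of_comm (T := T.sun) (sunRestrict_comm_op ⟨V, hV.mem⟩) hξ⟩
  obtain ⟨hV1, -, hV3⟩ := isCompl_range_ker_of_isIdempotentElem hVV
  obtain ⟨hP1, hP2, hP3⟩ := isCompl_range_ker_of_isIdempotentElem hPP
  have hminV := fun Q : X →L[ℂ] X => isMinimalIdempotent_iff_eq (K := T.weakCompactification)
    (e := V.toCLM) hV.mem hVV
    (fun a ha b hb => congrArg toCLM (wotClosure_mul_comm (R := ofCLM a) (S := ofCLM b) ha hb))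
    (fun s hs => by
      obtain ⟨R, hR, h⟩ := hV.exists_inv (ofCLM s) hs
      exact ⟨R.toCLM, hR, congrArg toCLM h⟩) Q
  have hminP := fun Q => isMinimalIdempotent_iff_eq (K := T.sunCompactification) (e := P)
    ((mem_sunCompactification_iff hT P).2 ⟨_, rfl⟩) hPP
    (fun a ha b hb => by
      obtain ⟨A, rfl⟩ := (mem_sunCompactification_iff hT a).1 ha
      obtain ⟨B, rfl⟩ := (mem_sunCompactification_iff hT b).1 hb
      refine ContinuousLinearMap.ext fun f => ?_
      change sunRestrict A (sunRestrict B f) = sunRestrict B (sunRestrict A f)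
      rw [sunRestrict_apply_eq (P := ⟨A.1 * B.1, mul_mem_wotClosure A.2 B.2⟩) rfl]
      exact sunRestrict_apply_eq (wotClosure_mul_comm B.2 A.2) f)
    (fun s hs => by
      obtain ⟨S, rfl⟩ := (mem_sunCompactification_iff hT s).1 hs
      obtain ⟨R, hR, h⟩ := hV.exists_inv S.1 S.2
      refine ⟨sunRestrict ⟨R, hR⟩, (mem_sunCompactification_iff hT _).2 ⟨_, rfl⟩,
        ContinuousLinearMap.ext fun f => ?_⟩
      change P (sunRestrict S (sunRestrict ⟨R, hR⟩ f)) = P f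
      rw [sunRestrict_apply_eq (R := ⟨R, hR⟩) (S := S)
        (P := ⟨R * S.1, mul_mem_wotClosure hR S.2⟩) rfl]
      refine sunRestrict_apply_eq ?_ f
      change R * S.1 * V = V
      rw [mul_assoc, wotClosure_mul_comm S.2 hV.mem,
        wotClosure_mul_comm hR (mul_mem_wotClosure hV.mem S.2), h]) Q
  refine ⟨V.toCLM, P, hjV, ⟨hVV, ?_, ?_, hV3⟩,
    ⟨fun Q => (hminV Q).1, fun Q => (hminV Q).2, fun Q => (hminP Q).1, fun Q => (hminP Q).2⟩,
    ⟨hPP, ?_, ?_, hP2 ▸ hP3⟩, ?_⟩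
  · ext x
    exact (hV1 x).trans
      ⟨apply_mem_almostPeriodicVectors hT hV, apply_eq_of_mem_almostPeriodicVectors hV⟩
  · ext x
    exact (mem_flightVectors_iff hT hV x).symm
  · ext f
    exact (hP1 f).trans (mem_sunReversible_iff hT hV f).symm
  · rw [hP2]
    ext f
    exact (mem_sunFlight_iff hT hV f).symm
  · rfl
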